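/- Let $\mathbb{P}$ be the set of all primes and let $\sigma=\{\sigma_i\mid i\in I\}$ be a partition of $\mathbb{P}$, that is, $\mathbb{P}=\bigcup_{i\in I}\sigma_i$ and $\sigma_i\cap\sigma_j=\emptyset$ for all $i\neq j$. All groups are finite. A $\sigma_i$-group is a group whose order has all its prime divisors in $\sigma_i$; a group is $\sigma$-primary if it is a $\sigma_i$-group for some $i\in I$, and $\sigma$-soluble if each of its chief factors is $\sigma$-primary. A Hall $\sigma_i$-subgroup of $G$ is a $\sigma_i$-subgroup $H$ of $G$ such that no prime in $\sigma_i$ divides $|G:H|$. A subgroup $A$ of $G$ is $\sigma$-subnormal in $G$ if there is a chain of subgroups $A=A_0\le A_1\le\cdots\le A_n=G$ such that, for each $k=1,\dots,n$, either $A_{k-1}$ is normal in $A_k$ or $A_k/(A_{k-1})_{A_k}$ is $\sigma$-primary, where $(A_{k-1})_{A_k}$ is the largest normal subgroup of $A_k$ contained in $A_{k-1}$. The group $G$ is a $T_\sigma$-group if every $\sigma$-subnormal subgroup of $G$ is normal in $G$; it is a $T$-group if $H\trianglelefteq K\trianglelefteq G$ always implies $H\trianglelefteq G$; and it is a Dedekind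 group if every subgroup of $G$ is normal in $G$. **Corollary 2.17.** A $\sigma$-soluble group $G$ is a $T_\sigma$-group if and only if $G$ is a $T$-group and, for every $i\in I$, every Hall $\sigma_i$-subgroup of $G$ is a Dedekind group. -/

import Mathlib

namespace SigmaGroup

/-- The family `σ` is a partition of the set of all primes (empty members are permitted). -/
structure IsPrimePartition {I : Type*} (σ : I → Set ℕ) : Prop where
  iUnion_eq : ⋃ i, σ i = {p : ℕ | p.Prime}
  disjoint : ∀ i j, i ≠ j → Disjoint (σ i) (σ j)

/-- All prime divisors of the order of the (finite) group `G` lie in `π`. -/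
def IsPiGroup (π : Set ℕ) (G : Type*) [Group G] : Prop :=
  ∀ p : ℕ, p.Prime → p ∣ Nat.card G → p ∈ π

/-- `G` is a `σ i`-group for some `i`. -/
def IsSigmaPrimary {I : Type*} (σ : I → Set ℕ) (G : Type*) [Group G] : Prop :=
  ∃ i, IsPiGroup (σ i) G

/-- Every chief factor `H / K` of `G` is `σ`-primary. -/
def IsSigmaSoluble {I : Type*} (σ : I → Set ℕ) (G : Type*) [Group G] : Prop :=
  ∀ (K H : Subgroup G) [K.Normal] [H.Normal], K < H →
    (∀ N : Subgroup G, N.Normal → K ≤ N → N ≤ H → N = K ∨ N = H) →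
    IsSigmaPrimary σ (H ⧸ K.subgroupOf H)

/-- `A` is `σ`-subnormal in `G`: there is a chain `A = c 0 ≤ c 1 ≤ ⋯ ≤ c n = G` in which each
`c i` is normal in `c (i + 1)`, or the quotient of `c (i + 1)` by the core of `c i` in `c (i + 1)`
is `σ`-primary. -/
def IsSigmaSubnormal {I : Type*} (σ : I → Set ℕ) {G : Type*} [Group G] (A : Subgroup G) : Prop :=
  ∃ (n : ℕ) (c : ℕ → Subgroup G), c 0 = A ∧ c n = ⊤ ∧
    ∀ i < n, c i ≤ c (i + 1) ∧
      (((c i).subgroupOf (c (i + 1))).Normal ∨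
        IsSigmaPrimary σ (c (i + 1) ⧸ ((c i).subgroupOf (c (i + 1))).normalCore))

/-- Every `σ`-subnormal subgroup of `G` is normal. -/
def IsTSigmaGroup {I : Type*} (σ : I → Set ℕ) (G : Type*) [Group G] : Prop :=
  ∀ A : Subgroup G, IsSigmaSubnormal σ A → A.Normal

/-- Normality is transitive in `G`. -/
def IsTGroup (G : Type*) [Group G] : Prop :=
  ∀ H K : Subgroup G, H ≤ K → (H.subgroupOf K).Normal → K.Normal → H.Normal

/-- `H` is a Hall `π`-subgroup of `G`: it is a `π`-group whose index has no prime divisor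
in `π`. -/
def IsHallSubgroup (π : Set ℕ) {G : Type*} [Group G] (H : Subgroup G) : Prop :=
  IsPiGroup π H ∧ ∀ p : ℕ, p.Prime → p ∣ H.index → p ∉ π

/-- Every subgroup of `G` is normal (abelian groups included). -/
def IsDedekindGroup (G : Type*) [Group G] : Prop :=
  ∀ H : Subgroup G, H.Normal

end SigmaGroup

/-! The `σ`-subnormal subgroups of a `T_σ`-group include everything between the ends of a
`σ`-primary section `M / K` with `K` and `M` normal. Hence the chief factors of a `σ`-soluble
`T_σ`-group are cyclic, so that its derived subgroup is nilpotent and lies in `O_π(G) O_π'(G)` for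
every set of primes `π`. For a Hall `σ i`-subgroup `H` and `N = O_{σ i'}(G)`, this makes `HN`
normal in `G`, so every subgroup between `N` and `HN` is normal in `G`, and intersecting with `H`
shows that `H` is Dedekind.

Conversely, let `A ≤ M` with `M` normal in a `T`-group and `M / A_M` a `σ i`-group. By
Schur–Zassenhaus there is a Hall `σ i`-subgroup of `G`; its intersection with `M` maps onto
`M / A_M`, which is therefore Dedekind, so `A` is normal in `M` and hence in `G`. Now descend along
a `σ`-subnormal chain. -/

namespace SigmaGroup

open Subgroup

section PiNumber

/-- `n` is a `π`-number: all its prime divisors lie in `π`. The number `0`, which is the `Nat.card`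
of an infinite group, is a `π`-number only if `π` contains every prime. -/
def IsPiNumber (π : Set ℕ) (n : ℕ) : Prop :=
  ∀ p : ℕ, p.Prime → p ∣ n → p ∈ π

variable {π : Set ℕ} {m n : ℕ}

theorem isPiNumber_one : IsPiNumber π 1 :=
  fun _ hp hd => (hp.ne_one (Nat.dvd_one.1 hd)).elim

theorem IsPiNumber.of_dvd (hn : IsPiNumber π n) (h : m ∣ n) : IsPiNumber π m :=
  fun p hp hd => hn p hp (hd.trans h)

theorem IsPiNumber.mul (hm : IsPiNumber π m) (hn : IsPiNumber π n) : IsPiNumber π (m * n) :=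
  fun p hp hd => (hp.dvd_mul.1 hd).elim (hm p hp) (hn p hp)

theorem IsPiNumber.coprime (hm : IsPiNumber π m) (hn : IsPiNumber πᶜ n) : m.Coprime n :=
  Nat.coprime_of_dvd fun p hp hpm hpn => hn p hp hpn (hm p hp hpm)

theorem IsPiNumber.eq_one (hn : IsPiNumber π n) (hn' : IsPiNumber πᶜ n) : n = 1 :=
  (Nat.coprime_self n).1 (hn.coprime hn')

end PiNumber

variable {G Q : Type*} [Group G] [Group Q] {π : Set ℕ}

theorem isPiGroup_iff : IsPiGroup π G ↔ IsPiNumber π (Nat.card G) :=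
  Iff.rfl

theorem isHallSubgroup_iff {H : Subgroup G} :
    IsHallSubgroup π H ↔ IsPiNumber π (Nat.card H) ∧ IsPiNumber πᶜ H.index :=
  Iff.rfl

section PiCore

theorem isPiGroup_of_isPGroup [Finite G] {p : ℕ} (hp : p.Prime) (hpπ : p ∈ π)
    (hG : IsPGroup p G) : IsPiGroup π G := by
  intro q hq hd
  have := Fact.mk hp
  obtain ⟨n, hn⟩ := hG.exists_card_eq
  rw [hn] at hd
  rwa [(Nat.prime_dvd_prime_iff_eq hq hp).1 (hq.dvd_of_dvd_pow hd)]

theorem IsPiGroup.sup {H K : Subgroup G} [K.Normal] (hH : IsPiGroup π H) (hK : IsPiGroup π K) :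
    IsPiGroup π (H ⊔ K : Subgroup G) := by
  have hcard : Nat.card K * K.relIndex H = Nat.card (H ⊔ K : Subgroup G) := by
    rw [← relIndex_sup_right, ← relIndex_bot_left, ← relIndex_bot_left,
      relIndex_mul_relIndex _ _ _ bot_le le_sup_right]
  rw [isPiGroup_iff] at hH hK ⊢
  exact hcard ▸ hK.mul (hH.of_dvd (relIndex_dvd_card K H))

/-- The `π`-core `O_π(G)`, the join of all normal `π`-subgroups. It is the largest of them when `G`
is finite. -/
def piCore (π : Set ℕ) (G : Type*) [Group G] : Subgroup G :=
  sSup {N : Subgroup G | N.Normal ∧ IsPiGroup π N}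

theorem le_piCore {N : Subgroup G} (hN : N.Normal) (hNπ : IsPiGroup π N) : N ≤ piCore π G :=
  le_sSup ⟨hN, hNπ⟩

instance piCore_normal : (piCore π G).Normal :=
  sSup_normal _ fun _ hN => hN.1

theorem isPiGroup_piCore [Finite G] : IsPiGroup π (piCore π G) := by
  have hsup : SupClosed {N : Subgroup G | N.Normal ∧ IsPiGroup π N} := by
    rintro H ⟨hH, hHπ⟩ K ⟨hK, hKπ⟩
    exact ⟨inferInstance, hHπ.sup hKπ⟩
  have hbot : IsPiGroup π (⊥ : Subgroup G) := by
    rw [isPiGroup_iff, card_bot]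
    exact isPiNumber_one
  have hmem : piCore π G ∈ {N : Subgroup G | N.Normal ∧ IsPiGroup π N} :=
    hsup.sSup_mem_of_nonempty (Set.toFinite _) ⟨⊥, inferInstance, hbot⟩ subset_rfl
  exact hmem.2

theorem eq_top_of_forall_exists_sylow_le [Finite G] {H : Subgroup G}
    (h : ∀ p : ℕ, p.Prime → ∃ P : Sylow p G, ↑P ≤ H) : H = ⊤ := by
  rw [← index_eq_one, Nat.eq_one_iff_not_exists_prime_dvd]
  intro p hp hdvd
  obtain ⟨P, hP⟩ := h p hp
  have := Fact.mk hp
  exact P.not_dvd_index (hdvd.trans (index_dvd_of_le hP))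

theorem le_piCore_sup_piCore_compl [Finite G] (F : Subgroup G) [F.Normal]
    [hF : Group.IsNilpotent F] : F ≤ piCore π G ⊔ piCore πᶜ G := by
  rw [← subgroupOf_eq_top]
  refine eq_top_of_forall_exists_sylow_le fun p hp => ?_
  have := Fact.mk hp
  obtain ⟨P⟩ : Nonempty (Sylow p F) := inferInstance
  have hPF : (P : Subgroup F).Normal :=
    (Group.isNilpotent_of_finite_tfae.out 0 3 :
      Group.IsNilpotent F ↔ ∀ (p : ℕ) (_ : Fact p.Prime) (P : Sylow p F),
        (P : Subgroup F).Normal).1 hF p this P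
  have := P.characteristic_of_normal hPF
  have hPG : ((P : Subgroup F).map F.subtype).Normal := inferInstance
  have hPp : IsPGroup p ((P : Subgroup F).map F.subtype) := P.isPGroup'.map F.subtype
  refine ⟨P, map_le_iff_le_comap.1 ?_⟩
  by_cases hpπ : p ∈ π
  · exact le_sup_of_le_left (le_piCore hPG (isPiGroup_of_isPGroup hp hpπ hPp))
  · exact le_sup_of_le_right (le_piCore hPG (isPiGroup_of_isPGroup hp hpπ hPp))

end PiCore

section Hall

variable {H : Subgroup G}

theorem IsHallSubgroup.le_of_normal (hH : IsHallSubgroup π H) {S : Subgroup G} [S.Normal]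
    (hS : IsPiGroup π S) : S ≤ H := by
  have hcard : IsPiNumber π (Nat.card (H ⊔ S : Subgroup G)) := hH.1.sup hS
  have hindex : H.relIndex (H ⊔ S) = 1 :=
    (hcard.of_dvd (relIndex_dvd_card ..)).eq_one
      ((isHallSubgroup_iff.1 hH).2.of_dvd (relIndex_dvd_index_of_le le_sup_left))
  exact le_sup_right.trans (relIndex_eq_one.1 hindex)

theorem IsHallSubgroup.map_eq_top (hH : IsHallSubgroup π H) {f : G →* Q}
    (hf : Function.Surjective f) (hQ : IsPiGroup π Q) : H.map f = ⊤ := by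
  rw [isPiGroup_iff] at hQ
  exact index_eq_one.1 <| (hQ.of_dvd (index_dvd_card _)).eq_one <|
    (isHallSubgroup_iff.1 hH).2.of_dvd (index_map_dvd _ hf)

theorem relIndex_sup_of_normal [Finite G] (H M : Subgroup G) [M.Normal] :
    H.relIndex (H ⊔ M) = H.relIndex M := by
  have h : M.relIndex H * H.relIndex (H ⊔ M) = H.relIndex M * M.relIndex H := by
    rw [← inf_relIndex_left H M, relIndex_mul_relIndex _ _ _ inf_le_left le_sup_left,
      inf_relIndex_left, ← relIndex_sup_right H M, ← inf_relIndex_right H M,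
      relIndex_mul_relIndex _ _ _ inf_le_right le_sup_right]
  rw [mul_comm] at h
  exact Nat.eq_of_mul_eq_mul_right (Nat.pos_of_ne_zero index_ne_zero_of_finite) h

theorem IsHallSubgroup.subgroupOf [Finite G] (hH : IsHallSubgroup π H) (M : Subgroup G)
    [M.Normal] : IsHallSubgroup π (H.subgroupOf M) := by
  have hdvd : H.relIndex M ∣ H.index :=
    relIndex_sup_of_normal H M ▸ relIndex_dvd_index_of_le le_sup_left
  rw [isHallSubgroup_iff] at hH ⊢
  exact ⟨hH.1.of_dvd (card_comap_dvd_of_injective H _ M.subtype_injective), hH.2.of_dvd hdvd⟩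

end Hall

section Dedekind

theorem IsDedekindGroup.of_injective (hQ : IsDedekindGroup Q) {f : G →* Q}
    (hf : Function.Injective f) : IsDedekindGroup G := fun A =>
  comap_map_eq_self_of_injective hf A ▸ (hQ (A.map f)).comap f

theorem IsDedekindGroup.of_surjective (hG : IsDedekindGroup G) {f : G →* Q}
    (hf : Function.Surjective f) : IsDedekindGroup Q := fun A =>
  map_comap_eq_self_of_surjective hf A ▸ (hG (A.comap f)).map f hf

theorem IsDedekindGroup.subgroupOf {H : Subgroup G} (hH : IsDedekindGroup H) (M : Subgroup G) :
    IsDedekindGroup (H.subgroupOf M) :=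
  hH.of_injective (f := M.subtype.subgroupComap H) fun _ _ hxy =>
    Subtype.ext (Subtype.ext (congrArg (fun z : H => (z : G)) hxy))

theorem isDedekindGroup_of_disjoint {H N : Subgroup G} [N.Normal] (hHN : Disjoint H N)
    (h : ∀ A ≤ H, (A ⊔ N).Normal) : IsDedekindGroup H := by
  intro A
  let f : H →* G ⧸ N := (QuotientGroup.mk' N).comp H.subtype
  have hf : Function.Injective f := by
    rw [← MonoidHom.ker_eq_bot_iff, ← MonoidHom.comap_ker, QuotientGroup.ker_mk']
    exact subgroupOf_eq_bot.2 hHN.symm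
  have hA : A = (A.map H.subtype ⊔ N).subgroupOf H := by
    conv_lhs => rw [← comap_map_eq_self_of_injective hf A, ← comap_comap, ← map_map, comap_map_eq,
      QuotientGroup.ker_mk']
    rfl
  have := h _ (map_subtype_le A)
  rw [hA]
  infer_instance

theorem IsHallSubgroup.normal_of_isDedekindGroup {H A : Subgroup G} (hH : IsHallSubgroup π H)
    (hD : IsDedekindGroup H) (hA : IsPiGroup π (G ⧸ A.normalCore)) : A.Normal := by
  let f := QuotientGroup.mk' A.normalCore
  have hHf : Function.Surjective (f.comp H.subtype) := by
    rw [← MonoidHom.range_eq_top, MonoidHom.range_comp, range_subtype]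
    exact hH.map_eq_top (QuotientGroup.mk'_surjective _) hA
  have hker : f.ker ≤ A := (QuotientGroup.ker_mk' _).trans_le A.normalCore_le
  exact comap_map_eq_self hker ▸ (hD.of_surjective hHf (A.map f)).comap f

end Dedekind

section ChiefFactor

/-- `H / K` is a chief factor of `G`: `K < H` are normal subgroups of `G` with no normal subgroup of
`G` strictly between them. -/
structure IsChiefFactor (K H : Subgroup G) : Prop where
  normal_left : K.Normal
  normal_right : H.Normal
  lt : K < H
  eq_or_eq : ∀ N : Subgroup G, N.Normal → K ≤ N → N ≤ H → N = K ∨ N = H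

theorem exists_isChiefFactor_of_ne_bot [Finite G] {H : Subgroup G} [hHn : H.Normal] (hH : H ≠ ⊥) :
    ∃ K : Subgroup G, IsChiefFactor K H := by
  obtain ⟨K, ⟨hK, hKH⟩, hmax⟩ :=
    (Set.toFinite {K : Subgroup G | K.Normal ∧ K < H}).exists_maximal
      ⟨⊥, inferInstance, bot_lt_iff_ne_bot.2 hH⟩
  refine ⟨K, hK, hHn, hKH, fun N hN hKN hNH => ?_⟩
  exact hNH.eq_or_lt.symm.imp_left fun hlt => (hmax ⟨hN, hlt⟩ hKN).antisymm hKN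

theorem chiefFactor_induction [Finite G] {motive : Subgroup G → Prop} (bot : motive ⊥)
    (step : ∀ K H, IsChiefFactor K H → motive K → motive H) (N : Subgroup G) (hN : N.Normal) :
    motive N := by
  induction N using WellFoundedLT.induction with
  | ind N ih =>
    obtain rfl | hbot := eq_or_ne N ⊥
    · exact bot
    · obtain ⟨K, hK⟩ := exists_isChiefFactor_of_ne_bot (hHn := hN) hbot
      exact step K N hK (ih K hK.lt hK.normal_left)

theorem isNilpotent_of_forall_commutator_le [Finite G] {D : Subgroup G}
    (h : ∀ K H, IsChiefFactor K H → ⁅H, D⁆ ≤ K) : Group.IsNilpotent D := by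
  have hle : ∃ n, (⊤ : Subgroup G).subgroupOf D ≤ Subgroup.upperCentralSeries D n := by
    refine chiefFactor_induction
      (motive := fun H => ∃ n, H.subgroupOf D ≤ Subgroup.upperCentralSeries D n)
      ⟨0, by simp⟩ ?_ ⊤ inferInstance
    rintro K H hKH ⟨n, hn⟩
    refine ⟨n + 1, fun x hx => Subgroup.mem_upperCentralSeries_succ_iff.2 fun y => hn ?_⟩
    exact h K H hKH (commutator_mem_commutator hx y.2)
  obtain ⟨n, hn⟩ := hle
  exact ⟨n, top_le_iff.1 hn⟩

theorem commutator_le_centralizer_of_isCyclic (C : Subgroup G) [C.Normal] [IsCyclic C] :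
    commutator G ≤ centralizer (C : Set G) := by
  -- `MulAut C` is abelian, so conjugation on `C` kills the derived subgroup.
  let e := IsCyclic.mulAutMulEquiv C
  let φ := e.toMonoidHom.comp (MulAut.conjNormal (H := C))
  intro x hx c hc
  have hφ : φ x = 1 := Abelianization.commutator_subset_ker φ hx
  have hconj : MulAut.conjNormal (H := C) x = 1 := e.map_eq_one_iff.1 hφ
  have hxc : x * c * x⁻¹ = c := by
    rw [← MulAut.conjNormal_apply x (⟨c, hc⟩ : C), hconj, MulAut.one_apply]
  exact (mul_inv_eq_iff_eq_mul.1 hxc).symm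

theorem commutator_le_of_isCyclic_map_mk' {K H : Subgroup G} [K.Normal] [H.Normal]
    [IsCyclic (H.map (QuotientGroup.mk' K))] : ⁅H, commutator G⁆ ≤ K := by
  let f := QuotientGroup.mk' K
  have : (H.map f).Normal := Normal.map ‹_› f (QuotientGroup.mk'_surjective K)
  have hle : (commutator G).map f ≤ commutator (G ⧸ K) := by
    rw [commutator_def, commutator_def, map_commutator]
    exact commutator_mono le_top le_top
  have hbot : ⁅H, commutator G⁆.map f = ⊥ := by
    rw [map_commutator, commutator_comm, commutator_eq_bot_iff_le_centralizer]
    exact hle.trans (commutator_le_centralizer_of_isCyclic (H.map f))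
  exact ((Subgroup.map_eq_bot_iff _).1 hbot).trans_eq (QuotientGroup.ker_mk' K)

end ChiefFactor

section HallExistence

/-- `G` is `π`-separable: each of its chief factors is a `π`-group or a `π'`-group. -/
def IsPiSeparable (π : Set ℕ) (G : Type*) [Group G] : Prop :=
  ∀ K H : Subgroup G, IsChiefFactor K H →
    IsPiNumber π (K.relIndex H) ∨ IsPiNumber πᶜ (K.relIndex H)

theorem relIndex_ker_comap_of_surjective {f : G →* Q} (hf : Function.Surjective f)
    (H : Subgroup Q) : f.ker.relIndex (H.comap f) = Nat.card H := by
  rw [relIndex_ker, map_comap_eq_self_of_surjective hf]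

theorem exists_isHallSubgroup_of_isPiGroup_ker {f : G →* Q} (hf : Function.Surjective f)
    (hker : IsPiGroup π f.ker) (hQ : ∃ H : Subgroup Q, IsHallSubgroup π H) :
    ∃ H : Subgroup G, IsHallSubgroup π H := by
  simp only [isHallSubgroup_iff] at hQ ⊢
  rw [isPiGroup_iff] at hker
  obtain ⟨H, hcard, hindex⟩ := hQ
  refine ⟨H.comap f, ?_, ?_⟩
  · rw [← relIndex_bot_left, ← relIndex_mul_relIndex ⊥ f.ker _ bot_le (f.ker_le_comap H),
      relIndex_bot_left, relIndex_ker_comap_of_surjective hf]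
    exact hker.mul hcard
  · rwa [index_comap_of_surjective _ hf]

theorem exists_isHallSubgroup_of_isPiGroup_compl_ker {f : G →* Q}
    (hf : Function.Surjective f) (hker : IsPiGroup πᶜ f.ker)
    (hQ : ∃ H : Subgroup Q, IsHallSubgroup π H) : ∃ H : Subgroup G, IsHallSubgroup π H := by
  simp only [isHallSubgroup_iff] at hQ ⊢
  rw [isPiGroup_iff] at hker
  obtain ⟨H, hcard, hindex⟩ := hQ
  let L := H.comap f
  let N := f.ker.subgroupOf L
  have hNcard : Nat.card N = Nat.card f.ker :=
    Nat.card_congr (subgroupOfEquivOfLe (f.ker_le_comap H)).toEquiv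
  have hNindex : N.index = Nat.card H := relIndex_ker_comap_of_surjective hf H
  obtain ⟨C, hC⟩ : ∃ C, IsComplement' N C := exists_right_complement'_of_coprime <| by
    rw [hNcard, hNindex]
    exact (hcard.coprime hker).symm
  refine ⟨C.map L.subtype, ?_, ?_⟩
  · rwa [card_map_of_injective L.subtype_injective, ← hC.symm.index_eq_card, hNindex]
  · rw [index_map_subtype, hC.index_eq_card, hNcard, index_comap_of_surjective _ hf]
    exact hker.mul hindex

theorem card_ker_quotientMap {N : Subgroup G} {M : Subgroup Q} [N.Normal] [M.Normal] {f : G →* Q}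
    (h : N ≤ M.comap f) : Nat.card (QuotientGroup.map N M f h).ker = N.relIndex (M.comap f) := by
  rw [QuotientGroup.ker_map, ← relIndex_ker, QuotientGroup.ker_mk']

theorem IsPiSeparable.exists_isHallSubgroup_of_quotient [Finite G] (hG : IsPiSeparable π G)
    (N : Subgroup G) [hN : N.Normal] (h : ∃ H : Subgroup (G ⧸ N), IsHallSubgroup π H) :
    ∃ H : Subgroup G, IsHallSubgroup π H := by
  refine chiefFactor_induction (motive := fun N => ∀ _ : N.Normal,
    (∃ H : Subgroup (G ⧸ N), IsHallSubgroup π H) → ∃ H : Subgroup G, IsHallSubgroup π H)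
    (fun _ hbot => ?_) (fun K M hKM ih _ hM => ?_) N hN hN h
  · refine exists_isHallSubgroup_of_isPiGroup_ker (QuotientGroup.mk'_surjective ⊥) ?_ hbot
    rw [QuotientGroup.ker_mk', isPiGroup_iff, card_bot]
    exact isPiNumber_one
  · have := hKM.normal_left
    have hle : K ≤ M.comap (MonoidHom.id G) := hKM.lt.le
    have hsurj : Function.Surjective (QuotientGroup.map K M (MonoidHom.id G) hle) :=
      QuotientGroup.map_surjective_of_surjective _ _ _ QuotientGroup.mk_surjective _
    have hπ := hG K M hKM
    rw [← comap_id M, ← card_ker_quotientMap hle] at hπ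
    exact ih this <| hπ.elim (exists_isHallSubgroup_of_isPiGroup_ker hsurj · hM)
      (exists_isHallSubgroup_of_isPiGroup_compl_ker hsurj · hM)

theorem IsPiSeparable.exists_isHallSubgroup [Finite G] (hG : IsPiSeparable π G) :
    ∃ H : Subgroup G, IsHallSubgroup π H := by
  refine hG.exists_isHallSubgroup_of_quotient ⊤ ⟨⊤, isHallSubgroup_iff.2 ⟨?_, ?_⟩⟩
  · simpa using isPiNumber_one
  · simpa using isPiNumber_one

end HallExistence

section SigmaSoluble

variable {I : Type*} {σ : I → Set ℕ}

theorem IsSigmaSoluble.exists_isPiNumber_relIndex (hG : IsSigmaSoluble σ G) {K H : Subgroup G}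
    (hKH : IsChiefFactor K H) : ∃ i, IsPiNumber (σ i) (K.relIndex H) :=
  have := hKH.normal_left
  have := hKH.normal_right
  hG K H hKH.lt hKH.eq_or_eq

theorem IsSigmaSoluble.isPiSeparable (hσ : IsPrimePartition σ) (hG : IsSigmaSoluble σ G) (i : I) :
    IsPiSeparable (σ i) G := by
  intro K H hKH
  obtain ⟨j, hj⟩ := hG.exists_isPiNumber_relIndex hKH
  obtain rfl | hij := eq_or_ne i j
  · exact Or.inl hj
  · exact Or.inr fun p hp hd => Set.disjoint_right.1 (hσ.disjoint i j hij) (hj p hp hd)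

theorem isSigmaSubnormal_of_le_normal {A M : Subgroup G} [M.Normal] (hAM : A ≤ M)
    (h : (A.subgroupOf M).Normal ∨ IsSigmaPrimary σ (M ⧸ (A.subgroupOf M).normalCore)) :
    IsSigmaSubnormal σ A := by
  refine ⟨2, fun | 0 => A | 1 => M | _ => ⊤, rfl, rfl, fun j hj => ?_⟩
  interval_cases j
  · exact ⟨hAM, h⟩
  · exact ⟨le_top, Or.inl inferInstance⟩

namespace IsTSigmaGroup

theorem isTGroup (hT : IsTSigmaGroup σ G) : IsTGroup G := fun H _ hHK hH _ =>
  hT H (isSigmaSubnormal_of_le_normal hHK (Or.inl hH))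

theorem normal_of_isPiNumber_relIndex (hT : IsTSigmaGroup σ G) {K A M : Subgroup G} [K.Normal]
    [M.Normal] (hKA : K ≤ A) (hAM : A ≤ M) {i : I} (h : IsPiNumber (σ i) (K.relIndex M)) :
    A.Normal :=
  hT A <| isSigmaSubnormal_of_le_normal hAM <| Or.inr
    ⟨i, h.of_dvd (index_dvd_of_le (normal_le_normalCore.2 (comap_mono hKA)))⟩

theorem isCyclic_map_mk' (hT : IsTSigmaGroup σ G) (hG : IsSigmaSoluble σ G) {K H : Subgroup G}
    [K.Normal] (hKH : IsChiefFactor K H) : IsCyclic (H.map (QuotientGroup.mk' K)) := by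
  have := hKH.normal_right
  obtain ⟨i, hi⟩ := hG.exists_isPiNumber_relIndex hKH
  obtain ⟨g, hgH, hgK⟩ := SetLike.exists_of_lt hKH.lt
  have hle : K ⊔ zpowers g ≤ H := sup_le hKH.lt.le (zpowers_le.2 hgH)
  have hnormal : (K ⊔ zpowers g).Normal := hT.normal_of_isPiNumber_relIndex le_sup_left hle hi
  have hH : K ⊔ zpowers g = H := (hKH.eq_or_eq _ hnormal le_sup_left hle).resolve_left
    fun h => hgK (h ▸ mem_sup_right (mem_zpowers g))
  rw [← hH, Subgroup.map_sup, QuotientGroup.map_mk'_self, bot_sup_eq, MonoidHom.map_zpowers]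
  infer_instance

theorem isNilpotent_commutator [Finite G] (hT : IsTSigmaGroup σ G) (hG : IsSigmaSoluble σ G) :
    Group.IsNilpotent (commutator G) :=
  isNilpotent_of_forall_commutator_le fun _ _ hKH =>
    have := hKH.normal_left
    have := hKH.normal_right
    have := hT.isCyclic_map_mk' hG hKH
    commutator_le_of_isCyclic_map_mk'

theorem isDedekindGroup_of_isHallSubgroup [Finite G] (hT : IsTSigmaGroup σ G)
    (hG : IsSigmaSoluble σ G) {i : I} {H : Subgroup G} (hH : IsHallSubgroup (σ i) H) :
    IsDedekindGroup H := by
  let N := piCore (σ i)ᶜ G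
  have hN : IsPiGroup (σ i)ᶜ N := isPiGroup_piCore
  have hnil := hT.isNilpotent_commutator hG
  have hcomm : commutator G ≤ H ⊔ N :=
    (le_piCore_sup_piCore_compl (commutator G)).trans
      (sup_le_sup_right (hH.le_of_normal isPiGroup_piCore) N)
  have hHN : (H ⊔ N).Normal := Normal.of_commutator_le _ hcomm
  have hindex : IsPiNumber (σ i) (N.relIndex (H ⊔ N)) := by
    rw [relIndex_sup_right]
    exact (isPiGroup_iff.1 hH.1).of_dvd (relIndex_dvd_card ..)
  have hdisj : Disjoint H N :=
    disjoint_of_coprime_natCard ((isPiGroup_iff.1 hH.1).coprime hN)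
  exact isDedekindGroup_of_disjoint hdisj fun A hAH =>
    hT.normal_of_isPiNumber_relIndex le_sup_right (sup_le_sup_right hAH N) hindex

end IsTSigmaGroup

theorem IsTGroup.isTSigmaGroup [Finite G] (hT : IsTGroup G)
    (hHall : ∀ i, ∃ H : Subgroup G, IsHallSubgroup (σ i) H ∧ IsDedekindGroup H) :
    IsTSigmaGroup σ G := by
  rintro A ⟨n, c, rfl, hn, hc⟩
  refine Nat.decreasingInduction' (P := fun k => (c k).Normal) (fun k hk _ hM => ?_)
    (Nat.zero_le n) (hn ▸ inferInstance)
  obtain ⟨hle, hnormal | ⟨i, hi⟩⟩ := hc k hk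
  · exact hT _ _ hle hnormal hM
  · obtain ⟨H, hH, hD⟩ := hHall i
    exact hT _ _ hle ((hH.subgroupOf _).normal_of_isDedekindGroup (hD.subgroupOf _) hi) hM

end SigmaSoluble

end SigmaGroup

theorem corollary2p17 {I : Type*} (σ : I → Set ℕ) (hσ : SigmaGroup.IsPrimePartition σ)
    (G : Type*) [Group G] [Finite G] (hG : SigmaGroup.IsSigmaSoluble σ G) :
    SigmaGroup.IsTSigmaGroup σ G ↔
      (SigmaGroup.IsTGroup G ∧
        ∀ (i : I) (H : Subgroup G), SigmaGroup.IsHallSubgroup (σ i) H →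
          SigmaGroup.IsDedekindGroup H) := by
  refine ⟨fun hT => ⟨hT.isTGroup, fun i H hH => hT.isDedekindGroup_of_isHallSubgroup hG hH⟩, ?_⟩
  rintro ⟨hT, hD⟩
  refine hT.isTSigmaGroup fun i => ?_
  obtain ⟨H, hH⟩ := (hG.isPiSeparable hσ i).exists_isHallSubgroup
  exact ⟨H, hH, hD i H hH⟩
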